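/- Let $N$ be a positive integer, let $\mathbb T^N$ be the $N$-dimensional torus with coordinates $e^{i\theta_1},\dots,e^{i\theta_N}$, and let $dx$ be its normalized Haar measure. Let $P^*\subset\mathbb Z^N$ be the lexicographic order consisting of $0$ and of all $m=(m_1,\dots,m_N)$ for which there is an index $j$ with $m_j>0$ and $m_i=0$ for all $i>j$. Let $H^1_{P^*}(\mathbb T^N)$ be the set of $f\in L^1(\mathbb T^N)$ whose Fourier coefficients $\widehat f(m)$ vanish for all $m\notin P^*$. For $0\le n\le N$ let $\mathcal F_n$ be the $\sigma$-algebra generated by the first $n$ coordinate functions $e^{i\theta_1},\dots,e^{i\theta_n}$, and for $f\in L^1(\mathbb T^N)$ put $$d_0(f)=\int_{\mathbb T^N}f\,dx,\qquad d_j(f)=\mathbb E(f\mid\mathcal F_j)-\mathbb E(f\mid\mathcal F_{j-1})\quad(1\le j\le N).$$ For $g\in L^1(\mathbb T^N)$ the integral $\int_{\mathbb T^N}\log|g|\,dx$ is understood in $[-\infty,\infty)$, with $\log 0=-\infty$ and $\exp(-\infty)=0$. **Proposition.** Suppose that $f\in H^1_{P^*}(\mathbb T^N)$. Then, for $n=0,1,\dots,N-1$,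 $$\exp\left(\int_{\mathbb T^N}\log\Bigl|\sum_{j=0}^{n}d_j(f)\Bigr|\,dx\right)\le\exp\left(\int_{\mathbb T^N}\log\Bigl|\sum_{j=0}^{n+1}d_j(f)\Bigr|\,dx\right),$$ and $$\left|\int_{\mathbb T^N}f\,dx\right|\le\exp\left(\int_{\mathbb T^N}\log|f|\,dx\right).$$ -/

import Mathlib

open MeasureTheory Set
open scoped ENNReal BigOperators

noncomputable section

namespace HardyTorus

/-- The normalized Haar measure `dx` on the torus `𝕋^N`, as the product of the normalized Haar
measures of the coordinate circles. The circle is modelled as `ℝ / ℤ`, the point `x` standing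
for `e^{2 π i x}`. -/
def haar (N : ℕ) : Measure (UnitAddTorus (Fin N)) :=
  Measure.pi fun _ => (AddCircle.haarAddCircle : Measure UnitAddCircle)

instance (N : ℕ) : IsProbabilityMeasure (haar N) := by
  unfold haar; infer_instance

/-- Mathlib's Fourier coefficients on the torus are the ones taken with respect to `haar N`. -/
theorem mFourierCoeff_eq (N : ℕ) (f : UnitAddTorus (Fin N) → ℂ) (m : Fin N → ℤ) :
    UnitAddTorus.mFourierCoeff f m = ∫ x, UnitAddTorus.mFourier (-m) x • f x ∂haar N :=
  rfl

/-- The lexicographic order `P^*` on `ℤ^N`, given by its set of nonnegative elements: `0`, and the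
`m` for which there is an index `j` with `m_j > 0` and `m_i = 0` for all `i > j`. -/
def lexOrder (N : ℕ) : Set (Fin N → ℤ) :=
  {0} ∪ ⋃ j : Fin N, {m | 0 < m j ∧ ∀ i, j < i → m i = 0}

/-- `f` represents an element of `H^1_P(𝕋^N)`: it is integrable and its Fourier transform vanishes
off `P`. -/
def MemH1 {N : ℕ} (P : Set (Fin N → ℤ)) (f : UnitAddTorus (Fin N) → ℂ) : Prop :=
  Integrable f (haar N) ∧ ∀ m ∉ P, UnitAddTorus.mFourierCoeff f m = 0

/-- The σ-algebra `𝓕_n` on `𝕋^N` generated by the first `n` coordinate functions. -/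
@[reducible] def sigmaFirst (N n : ℕ) : MeasurableSpace (UnitAddTorus (Fin N)) :=
  MeasurableSpace.comap
    (fun (x : UnitAddTorus (Fin N)) (j : {j : Fin N // (j : ℕ) < n}) => x j)
    MeasurableSpace.pi

theorem sigmaFirst_le (N n : ℕ) : sigmaFirst N n ≤ MeasurableSpace.pi :=
  Measurable.comap_le (measurable_pi_lambda _ fun j => measurable_pi_apply (j : Fin N))

/-- The martingale differences: `d_0(f) = ∫ f dx`, and
`d_j(f) = 𝔼(f | 𝓕_j) - 𝔼(f | 𝓕_{j-1})` for `j ≥ 1`. -/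
def mdiff {N : ℕ} (f : UnitAddTorus (Fin N) → ℂ) : ℕ → UnitAddTorus (Fin N) → ℂ
  | 0 => fun _ => ∫ x, f x ∂haar N
  | j + 1 => (haar N)[f | sigmaFirst N (j + 1)] - (haar N)[f | sigmaFirst N j]

/-- The integral `∫ log |g| dx` with values in `[-∞, ∞]`, where `log 0 = -∞`: the integral of the
positive part of `log |g|` minus the integral of its negative part. -/
def logIntegral {N : ℕ} (g : UnitAddTorus (Fin N) → ℂ) : EReal :=
  ((∫⁻ x, (ENNReal.log ‖g x‖ₑ).toENNReal ∂haar N : ℝ≥0∞) : EReal)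
    - ((∫⁻ x, (-ENNReal.log ‖g x‖ₑ).toENNReal ∂haar N : ℝ≥0∞) : EReal)

/-- For integrable `g` the positive part of `log |g|` has a finite integral, so that `∫ log |g| dx`
is well defined as an element of `[-∞, ∞)`. -/
theorem lintegral_log_pos_lt_top {N : ℕ} {g : UnitAddTorus (Fin N) → ℂ}
    (hg : Integrable g (haar N)) :
    ∫⁻ x, (ENNReal.log ‖g x‖ₑ).toENNReal ∂haar N < ⊤ := by
  refine lt_of_le_of_lt (lintegral_mono fun x => ?_) hg.hasFiniteIntegral
  rw [enorm_eq_nnnorm, ← ENNReal.ofReal_coe_nnreal, coe_nnnorm]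
  rcases (norm_nonneg (g x)).eq_or_lt with h | h
  · simp [← h]
  · rw [ENNReal.log_ofReal_of_pos h, EReal.toENNReal_of_ne_top (EReal.coe_ne_top _),
      EReal.toReal_coe]
    exact ENNReal.ofReal_le_ofReal ((Real.log_le_sub_one_of_pos h).trans (by linarith))

end HardyTorus

end

namespace HardyTorus

section

open Filter Topology UnitAddTorus
open scoped ComplexConjugate Pointwise

variable {N : ℕ}

/-! Partial sums of the `mdiff f j` are the conditional expectations `F_n = 𝔼(f | 𝓕_n)`, so the
claim is that `∫ log |F_n|` increases with `n`.

Analyticity enters through exponentials. If `h` is a trigonometric polynomial with frequencies in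
`posFreq n`, then `𝔼(f e^h | 𝓕_n) = F_n` (`condExp_mul_exp`), because every power of `h` has
frequencies that `f` annihilates. For a trigonometric polynomial `q`, the difference `𝔼(q | 𝓕_{n+1})
- 𝔼(q | 𝓕_n)` is the real part of such an `h`, up to an imaginary term. Jensen's inequality for the
norm then gives `∫ |F_n| exp Re 𝔼(q | 𝓕_n) ≤ ∫ |F_{n+1}| exp Re 𝔼(q | 𝓕_{n+1})`, and approximation
replaces `q` by any bounded real `U` (`integral_norm_condExp_mul_exp_le`).

Taking `U` close to `-log |F_{n+1}|` makes the right side about `1`, and `log t ≤ t - 1` on the left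
gives `∫ log |F_n| ≤ ∫ log (|F_{n+1}| + ε)` (`integral_log_norm_condExp_le`). Fatou's lemma removes
`ε` (`coe_le_logIntegral`). -/

instance : (haar N).IsAddRightInvariant := by
  unfold haar; infer_instance

/-! ### The filtration, and conditional expectations of characters. -/

theorem measurable_coord {n : ℕ} {i : Fin N} (hi : (i : ℕ) < n) :
    Measurable[sigmaFirst N n] fun x : UnitAddTorus (Fin N) => x i :=
  @Measurable.comp _ _ _ (sigmaFirst N n) MeasurableSpace.pi _ _ _
    (measurable_pi_apply (⟨i, hi⟩ : {j : Fin N // (j : ℕ) < n}))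
    (comap_measurable fun (x : UnitAddTorus (Fin N)) (j : {j : Fin N // (j : ℕ) < n}) => x j)

theorem sigmaFirst_mono {n k : ℕ} (h : n ≤ k) : sigmaFirst N n ≤ sigmaFirst N k := by
  refine Measurable.comap_le ?_
  exact @measurable_pi_lambda _ _ _ (sigmaFirst N k) _ _ fun j => measurable_coord (j.2.trans_le h)

theorem sigmaFirst_self : sigmaFirst N N = MeasurableSpace.pi := by
  exact le_antisymm (sigmaFirst_le N N)
    (iSup_le fun i => Measurable.comap_le (measurable_coord i.2))

theorem sigmaFirst_zero : sigmaFirst N 0 = ⊥ := by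
  have : IsEmpty {j : Fin N // (j : ℕ) < 0} := ⟨fun j => absurd j.2 (Nat.not_lt_zero _)⟩
  rw [eq_bot_iff]
  rintro s ⟨t, -, rfl⟩
  rcases t.eq_empty_or_nonempty with rfl | h
  · exact @MeasurableSet.empty _ ⊥
  · rw [Subsingleton.eq_univ_of_nonempty h]
    exact @MeasurableSet.univ _ ⊥

theorem stronglyMeasurable_mFourier {n : ℕ} {m : Fin N → ℤ}
    (hm : ∀ i : Fin N, n ≤ (i : ℕ) → m i = 0) :
    StronglyMeasurable[sigmaFirst N n] (mFourier m) := by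
  refine Measurable.stronglyMeasurable ?_
  change Measurable[sigmaFirst N n] fun x => ∏ i, fourier (m i) (x i)
  refine Finset.measurable_prod _ fun i _ => ?_
  by_cases hi : (i : ℕ) < n
  · exact (fourier (m i)).continuous.measurable.comp (measurable_coord hi)
  · simp only [hm i (not_lt.1 hi), fourier_zero]
    exact measurable_const

theorem integrable_continuousMap (G : C(UnitAddTorus (Fin N), ℂ)) : Integrable G (haar N) :=
  Integrable.of_bound G.continuous.aestronglyMeasurable ‖G‖ (ae_of_all _ G.norm_coe_le_norm)

theorem integrable_mul_continuousMap {f : UnitAddTorus (Fin N) → ℂ} (hf : Integrable f (haar N))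
    (G : C(UnitAddTorus (Fin N), ℂ)) : Integrable (fun x => f x * G x) (haar N) :=
  hf.mul_bdd G.continuous.aestronglyMeasurable (ae_of_all _ G.norm_coe_le_norm)

theorem condExp_mFourier_of_eq_zero {n : ℕ} {m : Fin N → ℤ}
    (hm : ∀ i : Fin N, n ≤ (i : ℕ) → m i = 0) :
    (haar N)[mFourier m | sigmaFirst N n] = mFourier m :=
  condExp_of_stronglyMeasurable (sigmaFirst_le N n) (stronglyMeasurable_mFourier hm)
    (integrable_continuousMap _)

theorem mFourier_add_single {m : Fin N → ℤ} {j : Fin N} (hj : m j ≠ 0)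
    (x : UnitAddTorus (Fin N)) :
    mFourier m (x + Pi.single j (((1 : ℝ) / 2 / m j : ℝ) : UnitAddCircle)) = -mFourier m x := by
  change ∏ i, fourier (m i) _ = -∏ i, fourier (m i) (x i)
  rw [← Finset.mul_prod_erase _ _ (Finset.mem_univ j), ← Finset.mul_prod_erase _ _
    (Finset.mem_univ j), ← neg_mul]
  congr 1
  · rw [Pi.add_apply, Pi.single_eq_same]
    exact fourier_add_half_inv_index hj one_pos _
  · refine Finset.prod_congr rfl fun i hi => ?_
    rw [Pi.add_apply, Pi.single_eq_of_ne (Finset.ne_of_mem_erase hi), add_zero]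

/-- Translating coordinate `j` by `1 / (2 m_j)` preserves Haar measure and every set of `𝓕_n`, but
flips the sign of the character. Hence its integral over such a set equals its own negative. -/
theorem condExp_mFourier_of_ne_zero {n : ℕ} {m : Fin N → ℤ} {j : Fin N} (hn : n ≤ (j : ℕ))
    (hj : m j ≠ 0) :
    (haar N)[mFourier m | sigmaFirst N n] =ᵐ[haar N] 0 := by
  symm
  refine ae_eq_condExp_of_forall_setIntegral_eq (sigmaFirst_le N n) (integrable_continuousMap _)
    (fun s _ _ => integrableOn_zero) (fun s hs _ => ?_) aestronglyMeasurable_zero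
  have hs' := sigmaFirst_le N n s hs
  obtain ⟨t, -, rfl⟩ := hs
  simp only [Pi.zero_apply, integral_zero]
  rw [← integral_indicator hs']
  set v : UnitAddTorus (Fin N) := Pi.single j (((1 : ℝ) / 2 / m j : ℝ) : UnitAddCircle) with hv
  have h := integral_add_right_eq_self (μ := haar N)
    (indicator ((fun (x : UnitAddTorus (Fin N)) (j : {j : Fin N // (j : ℕ) < n}) => x j) ⁻¹' t)
      (mFourier m)) v
  have h2 : ∀ x, indicator ((fun (x : UnitAddTorus (Fin N)) (j : {j : Fin N // (j : ℕ) < n}) =>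
      x j) ⁻¹' t) (mFourier m) (x + v) =
      -indicator ((fun (x : UnitAddTorus (Fin N)) (j : {j : Fin N // (j : ℕ) < n}) =>
      x j) ⁻¹' t) (mFourier m) x := by
    intro x
    have hx : (fun i : {j : Fin N // (j : ℕ) < n} => (x + v) i) =
        fun i : {j : Fin N // (j : ℕ) < n} => x i := by
      funext i
      have : (i : Fin N) ≠ j := fun h => by have := i.2; omega
      rw [Pi.add_apply, hv, Pi.single_eq_of_ne this, add_zero]
    have hiff : x + v ∈ ((fun (x : UnitAddTorus (Fin N)) (j : {j : Fin N // (j : ℕ) < n}) =>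
        x j) ⁻¹' t) ↔ x ∈ ((fun (x : UnitAddTorus (Fin N)) (j : {j : Fin N // (j : ℕ) < n}) =>
        x j) ⁻¹' t) := by
      rw [mem_preimage, mem_preimage, hx]
    by_cases hxt : x ∈ ((fun (x : UnitAddTorus (Fin N)) (j : {j : Fin N // (j : ℕ) < n}) =>
        x j) ⁻¹' t)
    · rw [indicator_of_mem hxt, indicator_of_mem (hiff.2 hxt), hv, mFourier_add_single hj]
    · rw [indicator_of_notMem hxt, indicator_of_notMem (fun h => hxt (hiff.1 h)), neg_zero]
  simp only [h2, integral_neg] at h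
  exact (CharZero.neg_eq_self_iff.1 h).symm

/-! ### Trigonometric approximation and uniqueness of Fourier coefficients. -/

/-- A bounded real function is approximated in mean by uniformly bounded trigonometric
polynomials. -/
theorem exists_mem_span_mFourier_integral_sub_le {U : UnitAddTorus (Fin N) → ℝ}
    (hU : AEStronglyMeasurable U (haar N)) {B : ℝ} (hB : ∀ x, |U x| ≤ B) {ε : ℝ} (hε : 0 < ε) :
    ∃ q ∈ Submodule.span ℂ (range (mFourier (d := Fin N))), ‖q‖ ≤ B + ε ∧
      ∫ x, ‖q x - U x‖ ∂haar N ≤ ε := by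
  have hUi : Integrable U (haar N) := Integrable.of_bound hU B (ae_of_all _ hB)
  obtain ⟨g, hg, hgi⟩ := hUi.exists_boundedContinuous_integral_sub_le (half_pos hε)
  have hB0 : 0 ≤ B := (abs_nonneg _).trans (hB 0)
  -- Truncating `g` to `[-B, B]` gives the uniform bound and, since `|U| ≤ B`, does not increase the
  -- distance to `U`.
  let G : C(UnitAddTorus (Fin N), ℂ) :=
    ⟨fun x => ((max (-B) (min B (g x)) : ℝ) : ℂ), by fun_prop⟩
  have hG : G ∈ (Submodule.span ℂ (range (mFourier (d := Fin N)))).topologicalClosure := by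
    rw [span_mFourier_closure_eq_top]; trivial
  obtain ⟨q, hq, hqG⟩ := Metric.mem_closure_iff.1 hG (ε / 2) (half_pos hε)
  have hGB : ‖G‖ ≤ B := by
    rw [ContinuousMap.norm_le _ hB0]
    intro x
    change ‖((max (-B) (min B (g x)) : ℝ) : ℂ)‖ ≤ B
    rw [Complex.norm_real, Real.norm_eq_abs, abs_le]
    exact ⟨le_max_left _ _, max_le (by linarith) (min_le_left _ _)⟩
  rw [dist_eq_norm] at hqG
  refine ⟨q, hq, ?_, ?_⟩
  · have := norm_sub_norm_le q G
    rw [norm_sub_rev] at this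
    linarith
  · have key : ∀ x, ‖q x - U x‖ ≤ ε / 2 + ‖U x - g x‖ := by
      intro x
      have h1 : ‖q x - G x‖ ≤ ε / 2 := by
        rw [norm_sub_rev]
        exact ((G - q).norm_coe_le_norm x).trans hqG.le
      have h2 : ‖G x - U x‖ ≤ ‖U x - g x‖ := by
        change ‖((max (-B) (min B (g x)) : ℝ) : ℂ) - _‖ ≤ _
        rw [← Complex.ofReal_sub, Complex.norm_real, Real.norm_eq_abs, Real.norm_eq_abs]
        have := abs_le.1 (hB x)
        rcases max_cases (-B) (min B (g x)) with h | h <;>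
        rcases min_cases B (g x) with h' | h' <;>
        rcases abs_cases (U x - g x) with h'' | h'' <;>
        rw [abs_le] <;> constructor <;> linarith
      calc ‖q x - U x‖ = ‖(q x - G x) + (G x - U x)‖ := by ring_nf
        _ ≤ _ := (norm_add_le _ _).trans (add_le_add h1 h2)
    refine (integral_mono ?_ ?_ key).trans ?_
    · exact ((integrable_continuousMap q).sub hUi.ofReal).norm
    · exact (integrable_const _).add (hUi.sub hgi).norm
    · have h := integral_add (integrable_const (ε / 2)) (hUi.sub hgi).norm
      simp only [Pi.sub_apply, integral_const, probReal_univ, one_smul] at h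
      linarith

/-- Integration against a fixed integrable function, as a functional on continuous functions. -/
noncomputable def integralMul {f : UnitAddTorus (Fin N) → ℂ} (hf : Integrable f (haar N)) :
    C(UnitAddTorus (Fin N), ℂ) →L[ℂ] ℂ :=
  LinearMap.mkContinuous
    { toFun := fun G => ∫ x, f x * G x ∂haar N
      map_add' := fun G H => by
        simp only [ContinuousMap.add_apply, mul_add]
        exact integral_add (integrable_mul_continuousMap hf G) (integrable_mul_continuousMap hf H)
      map_smul' := fun c G => by
        simp only [ContinuousMap.smul_apply, smul_eq_mul, RingHom.id_apply]
        rw [← integral_const_mul]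
        congr 1 with x
        ring }
    (∫ x, ‖f x‖ ∂haar N) fun G => by
      refine (norm_integral_le_integral_norm _).trans ?_
      rw [← integral_mul_const]
      refine integral_mono (integrable_mul_continuousMap hf G).norm (hf.norm.mul_const _) fun x => ?_
      change ‖f x * G x‖ ≤ ‖f x‖ * ‖G‖
      rw [norm_mul]
      gcongr
      exact G.norm_coe_le_norm x

theorem integralMul_apply {f : UnitAddTorus (Fin N) → ℂ} (hf : Integrable f (haar N))
    (G : C(UnitAddTorus (Fin N), ℂ)) : integralMul hf G = ∫ x, f x * G x ∂haar N := rfl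

theorem integralMul_eq_zero_of_mem_span {f : UnitAddTorus (Fin N) → ℂ}
    (hf : Integrable f (haar N)) {S : Set (Fin N → ℤ)}
    (h : ∀ m ∈ S, ∫ x, f x * mFourier m x ∂haar N = 0) {G : C(UnitAddTorus (Fin N), ℂ)}
    (hG : G ∈ Submodule.span ℂ (mFourier '' S)) : ∫ x, f x * G x ∂haar N = 0 := by
  have : Submodule.span ℂ (mFourier '' S) ≤ LinearMap.ker (integralMul hf).toLinearMap := by
    rw [Submodule.span_le]
    rintro _ ⟨m, hm, rfl⟩
    exact h m hm
  exact this hG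

theorem exists_seq_mem_span_mFourier {U : UnitAddTorus (Fin N) → ℝ}
    (hU : AEStronglyMeasurable U (haar N)) {B : ℝ} (hB : ∀ x, |U x| ≤ B) :
    ∃ q : ℕ → C(UnitAddTorus (Fin N), ℂ),
      (∀ k, q k ∈ Submodule.span ℂ (range (mFourier (d := Fin N)))) ∧ (∀ k, ‖q k‖ ≤ B + 1) ∧
      Tendsto (fun k => eLpNorm (⇑(q k) - fun x => (U x : ℂ)) 1 (haar N)) atTop (𝓝 0) := by
  choose q hq hqB hqU using fun k : ℕ => exists_mem_span_mFourier_integral_sub_le hU hB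
    (Nat.one_div_pos_of_nat (α := ℝ) (n := k))
  have hUi : Integrable U (haar N) := Integrable.of_bound hU B (ae_of_all _ hB)
  refine ⟨q, hq, fun k => (hqB k).trans ?_, ?_⟩
  · have : (1 : ℝ) / (k + 1) ≤ 1 := by
      rw [div_le_one (by positivity)]; linarith [(Nat.cast_nonneg k : (0 : ℝ) ≤ k)]
    linarith
  · have h0 : Tendsto (fun k : ℕ => ENNReal.ofReal (1 / ((k : ℝ) + 1))) atTop (𝓝 0) := by
      rw [← ENNReal.ofReal_zero]
      exact ENNReal.tendsto_ofReal tendsto_one_div_add_atTop_nhds_zero_nat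
    refine tendsto_of_tendsto_of_tendsto_of_le_of_le tendsto_const_nhds h0
      (fun _ => zero_le) fun k => ?_
    have hi : Integrable (⇑(q k) - fun x => (U x : ℂ)) (haar N) :=
      (integrable_continuousMap (q k)).sub hUi.ofReal
    rw [eLpNorm_one_eq_lintegral_enorm, ← ofReal_integral_norm_eq_lintegral_enorm hi]
    exact ENNReal.ofReal_le_ofReal (hqU k)

/-- Uniqueness of Fourier coefficients of integrable functions on the torus. -/
theorem ae_eq_zero_of_integral_mFourier_eq_zero {g : UnitAddTorus (Fin N) → ℂ}
    (hg : Integrable g (haar N)) (h : ∀ m, ∫ x, g x * mFourier m x ∂haar N = 0) :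
    g =ᵐ[haar N] 0 := by
  refine hg.ae_eq_zero_of_forall_setIntegral_eq_zero fun s hs _ => ?_
  -- The indicator of `s` is an a.e. limit of uniformly bounded trigonometric polynomials, so
  -- dominated convergence applies although `g` is only integrable.
  have hUm : AEStronglyMeasurable (indicator s fun _ => (1 : ℝ)) (haar N) :=
    aestronglyMeasurable_const.indicator hs
  obtain ⟨q, hq, hqB, hqU⟩ := exists_seq_mem_span_mFourier hUm (B := 1) fun x => by
    by_cases hx : x ∈ s <;> simp [hx]
  obtain ⟨ns, -, hns⟩ := (tendstoInMeasure_of_tendsto_eLpNorm one_ne_zero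
    (fun k => (q k).continuous.aestronglyMeasurable)
    (Complex.continuous_ofReal.comp_aestronglyMeasurable hUm) hqU).exists_seq_tendsto_ae
  have hlim : Tendsto (fun k => ∫ x, g x * q (ns k) x ∂haar N) atTop
      (𝓝 (∫ x, g x * ((indicator s (fun _ => (1 : ℝ)) x : ℝ) : ℂ) ∂haar N)) := by
    refine tendsto_integral_of_dominated_convergence (fun x => ‖g x‖ * (1 + 1))
      (fun k => (integrable_mul_continuousMap hg _).aestronglyMeasurable)
      (hg.norm.mul_const _) (fun k => ae_of_all _ fun x => ?_) ?_
    · rw [norm_mul]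
      gcongr
      exact ((q (ns k)).norm_coe_le_norm x).trans (hqB _)
    · filter_upwards [hns] with x hx
      exact hx.const_mul _
  have hzero : ∀ k, ∫ x, g x * q (ns k) x ∂haar N = 0 := fun k =>
    integralMul_eq_zero_of_mem_span hg (S := univ) (fun m _ => h m) (by
      rw [image_univ]; exact hq _)
  simp only [hzero] at hlim
  rw [← integral_indicator hs, tendsto_nhds_unique tendsto_const_nhds hlim]
  congr 1 with x
  by_cases hx : x ∈ s <;> simp [hx]

/-! ### Fourier coefficients of conditional expectations. -/

theorem condExp_mul_right {n : ℕ} {f g : UnitAddTorus (Fin N) → ℂ}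
    (hg : StronglyMeasurable[sigmaFirst N n] g)
    (hfg : Integrable (fun x => f x * g x) (haar N)) (hf : Integrable f (haar N)) :
    (haar N)[fun x => f x * g x | sigmaFirst N n] =ᵐ[haar N]
      fun x => ((haar N)[f | sigmaFirst N n]) x * g x :=
  condExp_bilin_of_stronglyMeasurable_right (ContinuousLinearMap.mul ℝ ℂ) hg hfg hf

theorem integral_condExp_mul_mFourier_of_eq_zero {n : ℕ} {g : UnitAddTorus (Fin N) → ℂ}
    (hg : Integrable g (haar N)) {m : Fin N → ℤ} (hm : ∀ i : Fin N, n ≤ (i : ℕ) → m i = 0) :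
    ∫ x, ((haar N)[g | sigmaFirst N n]) x * mFourier m x ∂haar N =
      ∫ x, g x * mFourier m x ∂haar N := by
  rw [← integral_condExp (sigmaFirst_le N n) (f := fun x => g x * mFourier m x)]
  exact integral_congr_ae (condExp_mul_right (stronglyMeasurable_mFourier hm)
    (integrable_mul_continuousMap hg _) hg).symm

theorem integral_condExp_mul_mFourier_of_ne_zero {n : ℕ} {g : UnitAddTorus (Fin N) → ℂ}
    {m : Fin N → ℤ} {j : Fin N} (hn : n ≤ (j : ℕ)) (hj : m j ≠ 0) :
    ∫ x, ((haar N)[g | sigmaFirst N n]) x * mFourier m x ∂haar N = 0 := by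
  have hi := integrable_mul_continuousMap
    (integrable_condExp (f := g) (m := sigmaFirst N n) (μ := haar N)) (mFourier m)
  rw [← integral_condExp (sigmaFirst_le N n)]
  have h := condExp_bilin_of_stronglyMeasurable_left (ContinuousLinearMap.mul ℝ ℂ)
    (stronglyMeasurable_condExp (f := g) (m := sigmaFirst N n) (μ := haar N)) hi
    (integrable_continuousMap (mFourier m))
  refine (integral_congr_ae h).trans ?_
  refine integral_eq_zero_of_ae ?_
  filter_upwards [condExp_mFourier_of_ne_zero hn hj] with x hx
  simp [hx]

/-- The conditional expectation on the first `n` coordinates is determined by the Fourier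
coefficients at frequencies in the first `n` coordinates. -/
theorem condExp_ae_eq_zero {n : ℕ} {g : UnitAddTorus (Fin N) → ℂ} (hg : Integrable g (haar N))
    (h : ∀ m : Fin N → ℤ, (∀ i : Fin N, n ≤ (i : ℕ) → m i = 0) →
      ∫ x, g x * mFourier m x ∂haar N = 0) :
    (haar N)[g | sigmaFirst N n] =ᵐ[haar N] 0 := by
  refine ae_eq_zero_of_integral_mFourier_eq_zero integrable_condExp fun m => ?_
  by_cases hm : ∀ i : Fin N, n ≤ (i : ℕ) → m i = 0
  · rw [integral_condExp_mul_mFourier_of_eq_zero hg hm, h m hm]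
  · push Not at hm
    obtain ⟨j, hn, hj⟩ := hm
    exact integral_condExp_mul_mFourier_of_ne_zero hn hj

/-! ### Exponentials of analytic polynomials acting on the Hardy space. -/

/-- The frequencies whose last nonzero entry is the `n`-th one, and is positive. -/
def posFreq (n : Fin N) : Set (Fin N → ℤ) := {m | 0 < m n ∧ ∀ i, n < i → m i = 0}

/-- Adding `a` leaves the last nonzero entry of `m` unchanged, so that of the negative is negative.
The sign appears because integration against `mFourier k` computes the coefficient at `-k`. -/
theorem neg_add_notMem_lexOrder {n : Fin N} {m a : Fin N → ℤ} (hm : m ∈ posFreq n)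
    (ha : ∀ i : Fin N, (n : ℕ) ≤ (i : ℕ) → a i = 0) : -(m + a) ∉ lexOrder N := by
  have hn : (m + a) n = m n := by simp [ha n le_rfl]
  have hi : ∀ i, n < i → (m + a) i = 0 := fun i hi => by
    simp [hm.2 i hi, ha i (Fin.le_def.1 hi.le)]
  rintro (h | h)
  · have h0 := congrFun h n
    rw [Pi.neg_apply, hn] at h0
    have := hm.1
    simp at h0
    omega
  · obtain ⟨j, hj, hj'⟩ := mem_iUnion.1 h
    rcases lt_trichotomy j n with h | rfl | h
    · have h0 := hj' n h
      rw [Pi.neg_apply, hn] at h0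
      have := hm.1
      omega
    · rw [Pi.neg_apply, hn] at hj
      have := hm.1
      omega
    · rw [Pi.neg_apply, hi j h] at hj
      omega

theorem pow_succ_mem_span_posFreq {n : Fin N} {h : C(UnitAddTorus (Fin N), ℂ)}
    (hh : h ∈ Submodule.span ℂ (mFourier '' posFreq n)) (k : ℕ) :
    h ^ (k + 1) ∈ Submodule.span ℂ (mFourier '' posFreq n) := by
  have hmul : Submodule.span ℂ (mFourier '' posFreq n) * Submodule.span ℂ (mFourier '' posFreq n) ≤
      Submodule.span ℂ (mFourier '' posFreq n) := by
    rw [Submodule.span_mul_span]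
    refine Submodule.span_mono ?_
    rintro _ ⟨_, ⟨m, hm, rfl⟩, _, ⟨m', hm', rfl⟩, rfl⟩
    refine ⟨m + m', ⟨add_pos hm.1 hm'.1, fun i hi => ?_⟩, ?_⟩
    · rw [Pi.add_apply, hm.2 i hi, hm'.2 i hi, add_zero]
    · ext x
      exact mFourier_add
  induction k with
  | zero => simpa using hh
  | succ k ih =>
    rw [pow_succ]
    exact hmul (Submodule.mul_mem_mul ih hh)

theorem exp_continuousMap_apply (h : C(UnitAddTorus (Fin N), ℂ)) (x : UnitAddTorus (Fin N)) :
    NormedSpace.exp h x = Complex.exp (h x) := by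
  rw [Complex.exp_eq_exp_ℂ]
  exact NormedSpace.map_exp (ContinuousMap.evalAlgHom ℂ ℂ x) (ContinuousMap.evalCLM ℂ x).continuous h

/-- In the exponential series, integrated term by term, all powers `h ^ (k + 1)` stay in the span of
`posFreq n`; only the constant term survives. -/
theorem integral_mul_exp_sub_one {n : Fin N} {g : UnitAddTorus (Fin N) → ℂ}
    (hg : Integrable g (haar N)) (hz : ∀ m ∈ posFreq n, ∫ x, g x * mFourier m x ∂haar N = 0)
    {h : C(UnitAddTorus (Fin N), ℂ)} (hh : h ∈ Submodule.span ℂ (mFourier '' posFreq n)) :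
    ∫ x, g x * NormedSpace.exp h x ∂haar N = ∫ x, g x ∂haar N := by
  have h1 := (integralMul hg).hasSum (NormedSpace.exp_series_hasSum_exp' (𝕂 := ℂ) h)
  have h2 : HasSum (fun k : ℕ => integralMul hg (((k.factorial : ℂ)⁻¹) • h ^ k))
      (integralMul hg 1) := by
    have := hasSum_single (f := fun k : ℕ => integralMul hg (((k.factorial : ℂ)⁻¹) • h ^ k)) 0
      fun k hk => by
        obtain ⟨k, rfl⟩ := Nat.exists_eq_succ_of_ne_zero hk
        rw [map_smul, integralMul_apply,
          integralMul_eq_zero_of_mem_span hg hz (pow_succ_mem_span_posFreq hh k), smul_zero]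
    simpa using this
  have h3 := h1.unique h2
  rw [integralMul_apply, integralMul_apply] at h3
  simpa using h3

/-- Multiplication by the exponential of an analytic trigonometric polynomial does not change the
conditional expectation of a function in `H¹`. -/
theorem condExp_mul_exp {f : UnitAddTorus (Fin N) → ℂ} (hf : MemH1 (lexOrder N) f) {n : Fin N}
    {h : C(UnitAddTorus (Fin N), ℂ)} (hh : h ∈ Submodule.span ℂ (mFourier '' posFreq n)) :
    (haar N)[fun x => f x * NormedSpace.exp h x | sigmaFirst N n] =ᵐ[haar N]
      (haar N)[f | sigmaFirst N n] := by
  have hi := integrable_mul_continuousMap hf.1 (NormedSpace.exp h)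
  -- It suffices to test `f e^h - f` against characters `a` in the first `n` coordinates; `f` times
  -- such a character still annihilates `posFreq n`.
  have h0 := condExp_ae_eq_zero (n := n) (hi.sub hf.1) fun a ha => by
    have hz : ∀ m ∈ posFreq n, ∫ x, f x * mFourier a x * mFourier m x ∂haar N = 0 := by
      intro m hm
      have := hf.2 _ (neg_add_notMem_lexOrder hm ha)
      rw [mFourierCoeff_eq, neg_neg] at this
      rw [← this]
      congr 1 with x
      rw [mFourier_add, smul_eq_mul]
      ring
    have hfa := integrable_mul_continuousMap hf.1 (mFourier a)
    have h1 := integral_mul_exp_sub_one hfa hz hh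
    rw [← sub_eq_zero, ← integral_sub (integrable_mul_continuousMap hfa _) hfa] at h1
    rw [← h1]
    congr 1 with x
    simp only [Pi.sub_apply]
    ring
  filter_upwards [h0, condExp_sub hi hf.1 (sigmaFirst N n)] with x h1 h2
  rw [h2] at h1
  exact sub_eq_zero.1 h1

/-! ### Martingale differences of trigonometric polynomials. -/

/-- The difference keeps the character exactly when its last nonzero entry is the one at `n`. The
sign of that entry decides whether it is analytic or the conjugate of an analytic character. -/
theorem condExp_succ_sub_condExp_mFourier (n : Fin N) (m : Fin N → ℤ) :
    ∃ h₁ ∈ Submodule.span ℂ (mFourier '' posFreq n), ∃ h₂ ∈ Submodule.span ℂ (mFourier '' posFreq n),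
      (haar N)[mFourier m | sigmaFirst N (n + 1)] - (haar N)[mFourier m | sigmaFirst N n]
        =ᵐ[haar N] fun x => h₁ x + conj (h₂ x) := by
  by_cases hm : ∀ i : Fin N, (n : ℕ) + 1 ≤ (i : ℕ) → m i = 0
  · have hm' : ∀ i : Fin N, n < i → m i = 0 := fun i hi => hm i hi
    rcases lt_trichotomy (m n) 0 with hn | hn | hn
    · refine ⟨0, Submodule.zero_mem _, mFourier (-m), Submodule.subset_span ⟨-m, ⟨?_, ?_⟩, rfl⟩, ?_⟩
      · simpa using hn
      · intro i hi
        simp [hm' i hi]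
      · rw [condExp_mFourier_of_eq_zero hm]
        filter_upwards [condExp_mFourier_of_ne_zero le_rfl hn.ne] with x hx
        simp [hx, mFourier_neg]
    · refine ⟨0, Submodule.zero_mem _, 0, Submodule.zero_mem _, ?_⟩
      rw [condExp_mFourier_of_eq_zero hm, condExp_mFourier_of_eq_zero]
      · exact ae_of_all _ fun x => by simp
      · intro i hi
        rcases hi.eq_or_lt with hi | hi
        · rw [← Fin.ext hi, hn]
        · exact hm i hi
    · refine ⟨mFourier m, Submodule.subset_span ⟨m, ⟨hn, hm'⟩, rfl⟩, 0, Submodule.zero_mem _, ?_⟩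
      rw [condExp_mFourier_of_eq_zero hm]
      filter_upwards [condExp_mFourier_of_ne_zero le_rfl hn.ne'] with x hx
      simp [hx]
  · push Not at hm
    obtain ⟨j, hj, hmj⟩ := hm
    refine ⟨0, Submodule.zero_mem _, 0, Submodule.zero_mem _, ?_⟩
    filter_upwards [condExp_mFourier_of_ne_zero hj hmj,
      condExp_mFourier_of_ne_zero (by omega : (n : ℕ) ≤ j) hmj] with x hx hx'
    simp [hx, hx']

theorem condExp_succ_sub_condExp (n : Fin N) {q : C(UnitAddTorus (Fin N), ℂ)}
    (hq : q ∈ Submodule.span ℂ (range (mFourier (d := Fin N)))) :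
    ∃ h₁ ∈ Submodule.span ℂ (mFourier '' posFreq n), ∃ h₂ ∈ Submodule.span ℂ (mFourier '' posFreq n),
      (haar N)[q | sigmaFirst N (n + 1)] - (haar N)[q | sigmaFirst N n]
        =ᵐ[haar N] fun x => h₁ x + conj (h₂ x) := by
  induction hq using Submodule.span_induction with
  | mem q hq =>
    obtain ⟨m, rfl⟩ := hq
    exact condExp_succ_sub_condExp_mFourier n m
  | zero =>
    refine ⟨0, Submodule.zero_mem _, 0, Submodule.zero_mem _, ?_⟩
    rw [ContinuousMap.coe_zero, condExp_zero, condExp_zero]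
    exact ae_of_all _ fun x => by simp
  | add p q _ _ hp hq =>
    obtain ⟨p₁, hp₁, p₂, hp₂, hp⟩ := hp
    obtain ⟨q₁, hq₁, q₂, hq₂, hq⟩ := hq
    refine ⟨p₁ + q₁, add_mem hp₁ hq₁, p₂ + q₂, add_mem hp₂ hq₂, ?_⟩
    rw [ContinuousMap.coe_add]
    filter_upwards [hp, hq, condExp_add (integrable_continuousMap p) (integrable_continuousMap q)
      (sigmaFirst N (n + 1)), condExp_add (integrable_continuousMap p) (integrable_continuousMap q)
      (sigmaFirst N n)] with x h1 h2 h3 h4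
    simp only [Pi.sub_apply, Pi.add_apply, ContinuousMap.add_apply, map_add] at *
    rw [h3, h4]
    linear_combination h1 + h2
  | smul c q _ hq =>
    obtain ⟨q₁, hq₁, q₂, hq₂, hq⟩ := hq
    refine ⟨c • q₁, Submodule.smul_mem _ _ hq₁, conj c • q₂, Submodule.smul_mem _ _ hq₂, ?_⟩
    rw [ContinuousMap.coe_smul]
    filter_upwards [hq, condExp_smul (μ := haar N) c q (sigmaFirst N (n + 1)),
      condExp_smul (μ := haar N) c q (sigmaFirst N n)] with x h1 h3 h4
    simp only [Pi.sub_apply, Pi.smul_apply, ContinuousMap.smul_apply, smul_eq_mul, map_mul,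
      Complex.conj_conj] at *
    rw [h3, h4]
    linear_combination c * h1

theorem stronglyMeasurable_of_mem_span_posFreq {n : Fin N} {h : C(UnitAddTorus (Fin N), ℂ)}
    (hh : h ∈ Submodule.span ℂ (mFourier '' posFreq n)) :
    StronglyMeasurable[sigmaFirst N (n + 1)] h := by
  induction hh using Submodule.span_induction with
  | mem q hq =>
    obtain ⟨m, hm, rfl⟩ := hq
    exact stronglyMeasurable_mFourier fun i hi => hm.2 i hi
  | zero => exact stronglyMeasurable_const
  | add p q _ _ hp hq => exact hp.add hq
  | smul c q _ hq => exact hq.const_smul c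

/-! ### The weighted inequality. -/

theorem integrable_norm_mul_exp_re {g p : UnitAddTorus (Fin N) → ℂ} (hg : Integrable g (haar N))
    (hp : AEStronglyMeasurable p (haar N)) {B : ℝ} (hB : ∀ᵐ x ∂haar N, ‖p x‖ ≤ B) :
    Integrable (fun x => ‖g x‖ * Real.exp (p x).re) (haar N) := by
  refine hg.norm.mul_bdd (c := Real.exp B) ?_ ?_
  · exact (Real.continuous_exp.comp Complex.continuous_re).comp_aestronglyMeasurable hp
  · filter_upwards [hB] with x hx
    rw [Real.norm_eq_abs, Real.abs_exp]
    exact Real.exp_le_exp.2 ((Complex.re_le_norm _).trans hx)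

theorem ae_norm_condExp_continuousMap_le (n : ℕ) (q : C(UnitAddTorus (Fin N), ℂ)) :
    ∀ᵐ x ∂haar N, ‖((haar N)[q | sigmaFirst N n]) x‖ ≤ ‖q‖ :=
  ae_bdd_norm_condExp_of_ae_bdd_norm (ae_of_all _ q.norm_coe_le_norm)

theorem integral_norm_condExp_mul_exp_le_of_mem_span {f : UnitAddTorus (Fin N) → ℂ}
    (hf : MemH1 (lexOrder N) f) (n : Fin N) {q : C(UnitAddTorus (Fin N), ℂ)}
    (hq : q ∈ Submodule.span ℂ (range (mFourier (d := Fin N)))) :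
    ∫ x, ‖((haar N)[f | sigmaFirst N n]) x‖ *
        Real.exp (((haar N)[q | sigmaFirst N n]) x).re ∂haar N ≤
      ∫ x, ‖((haar N)[f | sigmaFirst N (n + 1)]) x‖ *
        Real.exp (((haar N)[q | sigmaFirst N (n + 1)]) x).re ∂haar N := by
  obtain ⟨h₁, hh₁, h₂, hh₂, hh⟩ := condExp_succ_sub_condExp n hq
  -- `h₁ + h₂` is analytic and has the same real part as `h₁ + conj h₂`, hence its exponential has
  -- modulus `exp Re (𝔼(q | 𝓕_{n+1}) - 𝔼(q | 𝓕_n))`.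
  have hmem := add_mem hh₁ hh₂
  set G : C(UnitAddTorus (Fin N), ℂ) := NormedSpace.exp (h₁ + h₂) with hG
  have hGm : StronglyMeasurable[sigmaFirst N (n + 1)] G := by
    have : (G : UnitAddTorus (Fin N) → ℂ) = fun x => Complex.exp ((h₁ + h₂) x) :=
      funext fun x => exp_continuousMap_apply _ x
    rw [this]
    exact Complex.continuous_exp.comp_stronglyMeasurable
      (stronglyMeasurable_of_mem_span_posFreq hmem)
  set F := (haar N)[f | sigmaFirst N (n + 1)] with hF
  have hFi : Integrable F (haar N) := integrable_condExp
  have hFG : Integrable (fun x => F x * G x) (haar N) := integrable_mul_continuousMap hFi G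
  have hle : sigmaFirst N n ≤ sigmaFirst N (n + 1) := sigmaFirst_mono (Nat.le_succ _)
  have h1 : (haar N)[f | sigmaFirst N n] =ᵐ[haar N]
      (haar N)[fun x => F x * G x | sigmaFirst N n] := by
    refine (condExp_mul_exp hf hmem).symm.trans ?_
    refine (condExp_condExp_of_le hle (sigmaFirst_le N (n + 1))).symm.trans ?_
    exact condExp_congr_ae
      (condExp_mul_right hGm (integrable_mul_continuousMap hf.1 G) hf.1)
  set p := (haar N)[q | sigmaFirst N n] with hp
  have hpm : StronglyMeasurable[sigmaFirst N n] p := stronglyMeasurable_condExp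
  have hpa : AEStronglyMeasurable p (haar N) := integrable_condExp.aestronglyMeasurable
  have hpb := ae_norm_condExp_continuousMap_le n q
  have hi := integrable_norm_mul_exp_re hFG hpa hpb
  have hpull : (haar N)[fun x => ‖F x * G x‖ * Real.exp (p x).re | sigmaFirst N n] =ᵐ[haar N]
      fun x => ((haar N)[fun x => ‖F x * G x‖ | sigmaFirst N n]) x * Real.exp (p x).re :=
    condExp_mul_of_stronglyMeasurable_right
      ((Real.continuous_exp.comp Complex.continuous_re).comp_stronglyMeasurable hpm) hi hFG.norm
  calc ∫ x, ‖((haar N)[f | sigmaFirst N n]) x‖ * Real.exp (p x).re ∂haar N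
      ≤ ∫ x, ((haar N)[fun x => ‖F x * G x‖ | sigmaFirst N n]) x * Real.exp (p x).re ∂haar N := by
        refine integral_mono_ae (integrable_norm_mul_exp_re integrable_condExp hpa hpb)
          (integrable_condExp.congr hpull) ?_
        filter_upwards [h1, norm_condExp_le (m := sigmaFirst N n) (μ := haar N)
          (fun x => F x * G x)] with x hx hx'
        rw [hx]
        exact mul_le_mul_of_nonneg_right hx' (Real.exp_pos _).le
    _ = ∫ x, ‖F x * G x‖ * Real.exp (p x).re ∂haar N := by
        rw [← integral_congr_ae hpull, integral_condExp (sigmaFirst_le N n)]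
    _ = ∫ x, ‖F x‖ * Real.exp (((haar N)[q | sigmaFirst N (n + 1)]) x).re ∂haar N := by
        refine integral_congr_ae ?_
        filter_upwards [hh] with x hx
        have hre := congrArg Complex.re hx
        simp only [Pi.sub_apply, Complex.sub_re, Complex.add_re, Complex.conj_re] at hre
        rw [norm_mul, hG, exp_continuousMap_apply, Complex.norm_exp, mul_assoc, ← Real.exp_add]
        congr 2
        simp only [ContinuousMap.add_apply, Complex.add_re]
        linarith

/-- The weighted inequality behind the submartingale property of `log |𝔼(f | 𝓕_n)|`. -/
theorem integral_norm_condExp_mul_exp_le {f : UnitAddTorus (Fin N) → ℂ}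
    (hf : MemH1 (lexOrder N) f) (n : Fin N) {U : UnitAddTorus (Fin N) → ℝ}
    (hU : AEStronglyMeasurable U (haar N)) {B : ℝ} (hB : ∀ x, |U x| ≤ B) :
    ∫ x, ‖((haar N)[f | sigmaFirst N n]) x‖ *
        Real.exp (((haar N)[fun x => (U x : ℂ) | sigmaFirst N n]) x).re ∂haar N ≤
      ∫ x, ‖((haar N)[f | sigmaFirst N (n + 1)]) x‖ *
        Real.exp (((haar N)[fun x => (U x : ℂ) | sigmaFirst N (n + 1)]) x).re ∂haar N := by
  obtain ⟨q, hq, hqB, hqU⟩ := exists_seq_mem_span_mFourier hU hB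
  have hUi : Integrable (fun x => (U x : ℂ)) (haar N) :=
    (Integrable.of_bound hU B (ae_of_all _ hB)).ofReal
  have hmeas : ∀ k : ℕ, TendstoInMeasure (haar N)
      (fun i => (haar N)[q i | sigmaFirst N k]) atTop
      ((haar N)[fun x => (U x : ℂ) | sigmaFirst N k]) := fun k => by
    refine tendstoInMeasure_of_tendsto_eLpNorm one_ne_zero
      (fun i => integrable_condExp.aestronglyMeasurable) integrable_condExp.aestronglyMeasurable ?_
    refine tendsto_of_tendsto_of_tendsto_of_le_of_le tendsto_const_nhds hqU
      (fun _ => zero_le) fun i => ?_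
    rw [← eLpNorm_congr_ae (condExp_sub (integrable_continuousMap (q i)) hUi (sigmaFirst N k))]
    exact eLpNorm_condExp_le_eLpNorm _ le_rfl
  -- A subsequence for level `n`, then a further one for level `n + 1`, gives a.e. convergence at
  -- both levels.
  obtain ⟨ns, hns, hlim⟩ := (hmeas n).exists_seq_tendsto_ae
  obtain ⟨ms, hms, hlim'⟩ :=
    ((hmeas (n + 1)).comp hns.tendsto_atTop).exists_seq_tendsto_ae
  have hdom : ∀ (k : ℕ) (r : ℕ → ℕ), (∀ᵐ x ∂haar N, Tendsto
      (fun i => ((haar N)[q (r i) | sigmaFirst N k]) x) atTop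
      (𝓝 (((haar N)[fun x => (U x : ℂ) | sigmaFirst N k]) x))) →
      Tendsto (fun i => ∫ x, ‖((haar N)[f | sigmaFirst N k]) x‖ *
        Real.exp (((haar N)[q (r i) | sigmaFirst N k]) x).re ∂haar N) atTop
        (𝓝 (∫ x, ‖((haar N)[f | sigmaFirst N k]) x‖ *
        Real.exp (((haar N)[fun x => (U x : ℂ) | sigmaFirst N k]) x).re ∂haar N)) := by
    intro k r hr
    refine tendsto_integral_of_dominated_convergence
      (fun x => ‖((haar N)[f | sigmaFirst N k]) x‖ * Real.exp (B + 1)) (fun i => ?_)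
      (integrable_condExp.norm.mul_const _) (fun i => ?_) ?_
    · exact (integrable_norm_mul_exp_re integrable_condExp
        integrable_condExp.aestronglyMeasurable
        (ae_norm_condExp_continuousMap_le k (q (r i)))).aestronglyMeasurable
    · filter_upwards [ae_norm_condExp_continuousMap_le k (q (r i))] with x hx
      rw [norm_mul, norm_norm, Real.norm_eq_abs, Real.abs_exp]
      gcongr
      exact (Complex.re_le_norm _).trans (hx.trans (hqB _))
    · filter_upwards [hr] with x hx
      exact (((Real.continuous_exp.comp Complex.continuous_re).tendsto _).comp hx).const_mul _
  refine le_of_tendsto_of_tendsto' (hdom n (ns ∘ ms) ?_) (hdom (n + 1) (ns ∘ ms) hlim') fun i =>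
    integral_norm_condExp_mul_exp_le_of_mem_span hf n (hq _)
  filter_upwards [hlim] with x hx
  exact hx.comp hms.tendsto_atTop

/-! ### From the weighted inequality to logarithms. -/

theorem integrable_log_norm_add {g : UnitAddTorus (Fin N) → ℂ} (hg : Integrable g (haar N))
    {ε : ℝ} (hε : 0 < ε) : Integrable (fun x => Real.log (‖g x‖ + ε)) (haar N) := by
  refine Integrable.mono' ((hg.norm.add (integrable_const (ε + |Real.log ε|)))) ?_
    (ae_of_all _ fun x => ?_)
  · exact (Real.measurable_log.comp_aemeasurable
      (hg.aestronglyMeasurable.norm.aemeasurable.add_const ε)).aestronglyMeasurable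
  · have h0 := norm_nonneg (g x)
    have h1 := Real.log_le_sub_one_of_pos (by linarith : 0 < ‖g x‖ + ε)
    have h2 := Real.log_le_log hε (by linarith : ε ≤ ‖g x‖ + ε)
    have h3 := neg_abs_le (Real.log ε)
    have h4 := abs_nonneg (Real.log ε)
    rw [Real.norm_eq_abs, abs_le]
    simp only [Pi.add_apply]
    constructor <;> linarith

theorem integral_log_norm_condExp_le {f : UnitAddTorus (Fin N) → ℂ}
    (hf : MemH1 (lexOrder N) f) (n : Fin N)
    (h0 : ∀ᵐ x ∂haar N, ((haar N)[f | sigmaFirst N n]) x ≠ 0)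
    (hlog : Integrable (fun x => Real.log ‖((haar N)[f | sigmaFirst N n]) x‖) (haar N))
    {ε : ℝ} (hε : 0 < ε) :
    ∫ x, Real.log ‖((haar N)[f | sigmaFirst N n]) x‖ ∂haar N ≤
      ∫ x, Real.log (‖((haar N)[f | sigmaFirst N (n + 1)]) x‖ + ε) ∂haar N := by
  set g := (haar N)[f | sigmaFirst N (n + 1)] with hg
  have hgi : Integrable g (haar N) := integrable_condExp
  have hgm : StronglyMeasurable[sigmaFirst N (n + 1)] g := stronglyMeasurable_condExp
  have hL := integrable_log_norm_add hgi hε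
  suffices H : ∀ M : ℝ, 0 < M → ∫ x, Real.log ‖((haar N)[f | sigmaFirst N n]) x‖ ∂haar N ≤
      ∫ x, Real.log (‖g x‖ + ε) ∂haar N + (∫ x, ‖g x‖ ∂haar N) / M by
    have hlim : Tendsto (fun M : ℝ => ∫ x, Real.log (‖g x‖ + ε) ∂haar N +
        (∫ x, ‖g x‖ ∂haar N) / M) atTop (𝓝 (∫ x, Real.log (‖g x‖ + ε) ∂haar N + 0)) :=
      tendsto_const_nhds.add (tendsto_const_nhds.div_atTop tendsto_id)
    rw [add_zero] at hlim
    refine ge_of_tendsto hlim ?_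
    filter_upwards [eventually_gt_atTop 0] with M hM using H M hM
  intro M hM
  -- A bounded substitute for `-log |g|`: `ε` bounds it above, `M` below. Being
  -- `𝓕_{n+1}`-measurable, it equals its own conditional expectation there. The truncation costs at
  -- most `‖g‖₁ / M`.
  set U : UnitAddTorus (Fin N) → ℝ := fun x => -Real.log (min ‖g x‖ M + ε) with hU
  have hmin : ∀ x, 0 ≤ min ‖g x‖ M := fun x => le_min (norm_nonneg _) hM.le
  have hUm : StronglyMeasurable[sigmaFirst N (n + 1)] U := by
    refine Measurable.stronglyMeasurable ?_
    exact (Real.measurable_log.comp ((hgm.norm.measurable.min measurable_const).add_const ε)).neg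
  have hUa : AEStronglyMeasurable U (haar N) :=
    (hUm.mono (sigmaFirst_le N (n + 1))).aestronglyMeasurable
  have hUB : ∀ x, |U x| ≤ max |Real.log ε| |Real.log (M + ε)| := fun x => by
    have h1 := Real.log_le_log hε (by linarith [hmin x] : ε ≤ min ‖g x‖ M + ε)
    have h2 := Real.log_le_log (by linarith [hmin x])
      (by linarith [min_le_right ‖g x‖ M] : min ‖g x‖ M + ε ≤ M + ε)
    rw [hU, abs_neg]
    exact abs_le_max_abs_abs h1 h2
  have hUi : Integrable U (haar N) := Integrable.of_bound hUa _ (ae_of_all _ hUB)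
  have hUi' : Integrable (fun x => (U x : ℂ)) (haar N) := hUi.ofReal
  have hUB' : ∀ᵐ x ∂haar N, ‖(U x : ℂ)‖ ≤ max |Real.log ε| |Real.log (M + ε)| :=
    ae_of_all _ fun x => by rw [Complex.norm_real]; exact hUB x
  set p := (haar N)[fun x => (U x : ℂ) | sigmaFirst N n] with hp
  have hpi : Integrable p (haar N) := integrable_condExp
  have hpU : ∫ x, (p x).re ∂haar N = ∫ x, U x ∂haar N := by
    have h := integral_condExp (μ := haar N) (sigmaFirst_le N n) (f := fun x => (U x : ℂ))
    have h1 : ∫ x, (p x).re ∂haar N = (∫ x, p x ∂haar N).re := integral_re hpi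
    rw [h1, h]
    exact (congrArg Complex.re integral_complex_ofReal).trans (Complex.ofReal_re _)
  have hkey := integral_norm_condExp_mul_exp_le hf n hUa hUB
  rw [condExp_of_stronglyMeasurable (sigmaFirst_le N (n + 1))
    (Complex.continuous_ofReal.comp_stronglyMeasurable hUm) hUi'] at hkey
  have hright : ∫ x, ‖g x‖ * Real.exp ((U x : ℂ)).re ∂haar N ≤
      1 + (∫ x, ‖g x‖ ∂haar N) / M := by
    have h1 : ∫ x, (1 + ‖g x‖ / M) ∂haar N = 1 + (∫ x, ‖g x‖ ∂haar N) / M := by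
      rw [integral_add (integrable_const _) (hgi.norm.div_const _), integral_div]
      simp
    rw [← h1]
    refine integral_mono (integrable_norm_mul_exp_re hgi hUi'.aestronglyMeasurable hUB')
      ((integrable_const _).add (hgi.norm.div_const _)) fun x => ?_
    have hpos : 0 < min ‖g x‖ M + ε := by linarith [hmin x]
    change ‖g x‖ * Real.exp (-Real.log (min ‖g x‖ M + ε)) ≤ 1 + ‖g x‖ / M
    rw [Real.exp_neg, Real.exp_log hpos, ← div_eq_mul_inv]
    rcases le_total ‖g x‖ M with h | h
    · rw [min_eq_left h]
      have : ‖g x‖ / (‖g x‖ + ε) ≤ 1 := div_le_one_of_le₀ (by linarith) (by positivity)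
      have : 0 ≤ ‖g x‖ / M := by positivity
      linarith
    · rw [min_eq_right h]
      have : ‖g x‖ / (M + ε) ≤ ‖g x‖ / M :=
        div_le_div_of_nonneg_left (norm_nonneg _) hM (by linarith)
      linarith
  -- Integrate `log t ≤ t - 1` at `t = |F_n| exp Re p`, using that `Re p` and `U` have equal
  -- integrals.
  have hleft : ∫ x, Real.log ‖((haar N)[f | sigmaFirst N n]) x‖ ∂haar N + ∫ x, U x ∂haar N ≤
      ∫ x, ‖((haar N)[f | sigmaFirst N n]) x‖ * Real.exp (p x).re ∂haar N - 1 := by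
    have hpre : Integrable (fun x => (p x).re) (haar N) := hpi.re
    have hpe := integrable_norm_mul_exp_re (integrable_condExp (f := f) (m := sigmaFirst N n))
      hpi.aestronglyMeasurable (ae_bdd_norm_condExp_of_ae_bdd_norm hUB')
    have h1 : ∫ x, (‖((haar N)[f | sigmaFirst N n]) x‖ * Real.exp (p x).re - 1) ∂haar N =
        ∫ x, ‖((haar N)[f | sigmaFirst N n]) x‖ * Real.exp (p x).re ∂haar N - 1 := by
      rw [integral_sub hpe (integrable_const _)]
      simp
    rw [← hpU, ← integral_add hlog hpre, ← h1]
    refine integral_mono_ae (hlog.add hpre) (hpe.sub (integrable_const _)) ?_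
    filter_upwards [h0] with x hx
    have hx' := norm_pos_iff.2 hx
    have := Real.log_le_sub_one_of_pos (mul_pos hx' (Real.exp_pos (p x).re))
    rwa [Real.log_mul hx'.ne' (Real.exp_pos _).ne', Real.log_exp] at this
  have hU' : -∫ x, U x ∂haar N ≤ ∫ x, Real.log (‖g x‖ + ε) ∂haar N := by
    rw [← integral_neg]
    refine integral_mono hUi.neg hL fun x => ?_
    simp only [hU, neg_neg]
    exact Real.log_le_log (by linarith [hmin x]) (by linarith [min_le_left ‖g x‖ M])
  linarith

/-! ### The extended-valued logarithmic integral and the limit in `ε`. -/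

theorem toENNReal_log_enorm (z : ℂ) :
    (ENNReal.log ‖z‖ₑ).toENNReal = ENNReal.ofReal (Real.log ‖z‖) := by
  rcases eq_or_ne z 0 with rfl | hz
  · simp
  · rw [← ofReal_norm, ENNReal.log_ofReal_of_pos (norm_pos_iff.2 hz),
      EReal.real_coe_toENNReal]

theorem toENNReal_neg_log_enorm {z : ℂ} (hz : z ≠ 0) :
    (-ENNReal.log ‖z‖ₑ).toENNReal = ENNReal.ofReal (-Real.log ‖z‖) := by
  rw [← ofReal_norm, ENNReal.log_ofReal_of_pos (norm_pos_iff.2 hz), ← EReal.coe_neg,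
    EReal.real_coe_toENNReal]

theorem ofReal_log_add_le {t ε : ℝ} (ht : 0 ≤ t) (hε : 0 < ε) :
    ENNReal.ofReal (Real.log (t + ε)) ≤ ENNReal.ofReal (Real.log t) + ENNReal.ofReal ε := by
  rcases le_or_gt 1 t with h | h
  · have h1 : Real.log (t + ε) ≤ Real.log t + ε := by
      have h2 : t + ε = t * (1 + ε / t) := by field_simp
      rw [h2, Real.log_mul (by linarith) (by positivity)]
      have h3 := Real.log_le_sub_one_of_pos (by positivity : 0 < 1 + ε / t)
      have h4 : ε / t ≤ ε := div_le_self hε.le h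
      linarith
    rw [← ENNReal.ofReal_add (Real.log_nonneg h) hε.le]
    exact ENNReal.ofReal_le_ofReal h1
  · have h1 := Real.log_le_sub_one_of_pos (by linarith : 0 < t + ε)
    exact (ENNReal.ofReal_le_ofReal (by linarith)).trans le_add_self

theorem aemeasurable_neg_log {g : UnitAddTorus (Fin N) → ℂ} (hg : Integrable g (haar N)) :
    AEMeasurable (fun x => (-ENNReal.log ‖g x‖ₑ).toENNReal) (haar N) := by
  have h : Measurable fun y : ℝ≥0∞ => (-ENNReal.log y).toENNReal :=
    measurable_ereal_toENNReal.comp (continuous_neg.measurable.comp ENNReal.measurable_log)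
  exact h.comp_aemeasurable hg.aestronglyMeasurable.enorm

theorem logIntegral_congr {g h : UnitAddTorus (Fin N) → ℂ} (hgh : g =ᵐ[haar N] h) :
    logIntegral g = logIntegral h := by
  unfold logIntegral
  congr 2 <;> refine lintegral_congr_ae ?_ <;> filter_upwards [hgh] with x hx <;> rw [hx]

theorem logIntegral_const (c : ℂ) : logIntegral (fun _ : UnitAddTorus (Fin N) => c) =
    ENNReal.log ‖c‖ₑ := by
  simp only [logIntegral, lintegral_const, measure_univ, mul_one]
  induction ENNReal.log ‖c‖ₑ with
  | bot => simp
  | top => simp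
  | coe r =>
    rw [← EReal.coe_neg]
    rcases le_total 0 r with h | h
    · rw [EReal.coe_toENNReal (EReal.coe_nonneg.2 h),
        EReal.toENNReal_of_nonpos (EReal.coe_nonpos.2 (neg_nonpos.2 h))]
      simp
    · rw [EReal.toENNReal_of_nonpos (EReal.coe_nonpos.2 h),
        EReal.coe_toENNReal (EReal.coe_nonneg.2 (neg_nonneg.2 h))]
      simp

theorem integrable_log_norm {g : UnitAddTorus (Fin N) → ℂ} (hg : Integrable g (haar N))
    (h0 : ∀ᵐ x ∂haar N, g x ≠ 0)
    (hneg : ∫⁻ x, (-ENNReal.log ‖g x‖ₑ).toENNReal ∂haar N ≠ ⊤) :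
    Integrable (fun x => Real.log ‖g x‖) (haar N) := by
  refine ⟨(Real.measurable_log.comp_aemeasurable
    hg.aestronglyMeasurable.norm.aemeasurable).aestronglyMeasurable, ?_⟩
  refine lt_of_le_of_lt (lintegral_mono_ae (g := fun x => (ENNReal.log ‖g x‖ₑ).toENNReal +
    (-ENNReal.log ‖g x‖ₑ).toENNReal) ?_) ?_
  · filter_upwards [h0] with x hx
    rw [toENNReal_log_enorm, toENNReal_neg_log_enorm hx, Real.enorm_eq_ofReal_abs]
    rcases abs_cases (Real.log ‖g x‖) with h | h
    · rw [h.1]; exact le_self_add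
    · rw [h.1]; exact le_add_self
  · rw [lintegral_add_right' _ (aemeasurable_neg_log hg)]
    exact ENNReal.add_lt_top.2 ⟨lintegral_log_pos_lt_top hg, hneg.lt_top⟩

theorem logIntegral_eq_integral {g : UnitAddTorus (Fin N) → ℂ} (hg : Integrable g (haar N))
    (h0 : ∀ᵐ x ∂haar N, g x ≠ 0)
    (hneg : ∫⁻ x, (-ENNReal.log ‖g x‖ₑ).toENNReal ∂haar N ≠ ⊤) :
    logIntegral g = ((∫ x, Real.log ‖g x‖ ∂haar N : ℝ) : EReal) := by
  rw [integral_eq_lintegral_pos_part_sub_lintegral_neg_part (integrable_log_norm hg h0 hneg),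
    logIntegral, EReal.coe_sub]
  have h1 : ∫⁻ x, (-ENNReal.log ‖g x‖ₑ).toENNReal ∂haar N =
      ∫⁻ x, ENNReal.ofReal (-Real.log ‖g x‖) ∂haar N := by
    refine lintegral_congr_ae ?_
    filter_upwards [h0] with x hx using toENNReal_neg_log_enorm hx
  have h2 : ∫⁻ x, (ENNReal.log ‖g x‖ₑ).toENNReal ∂haar N =
      ∫⁻ x, ENNReal.ofReal (Real.log ‖g x‖) ∂haar N := by
    simp only [toENNReal_log_enorm]
  have h3 := (lintegral_log_pos_lt_top hg).ne
  rw [h1] at hneg ⊢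
  rw [h2] at h3 ⊢
  rw [EReal.coe_ennreal_toReal h3, EReal.coe_ennreal_toReal hneg]

/-- A lower bound for all `∫ log (|g| + ε) dx` is a lower bound for `∫ log |g| dx`. -/
theorem coe_le_logIntegral {g : UnitAddTorus (Fin N) → ℂ} (hg : Integrable g (haar N)) {a : ℝ}
    (h : ∀ ε : ℝ, 0 < ε → a ≤ ∫ x, Real.log (‖g x‖ + ε) ∂haar N) : (a : EReal) ≤ logIntegral g := by
  set P := ∫⁻ x, (ENNReal.log ‖g x‖ₑ).toENNReal ∂haar N with hP
  have hPt : P ≠ ⊤ := (lintegral_log_pos_lt_top hg).ne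
  have hpos : ∀ ε : ℝ, 0 < ε → ∫⁻ x, ENNReal.ofReal (Real.log (‖g x‖ + ε)) ∂haar N ≤
      P + ENNReal.ofReal ε := fun ε hε => by
    have h1 : ∫⁻ _, ENNReal.ofReal ε ∂haar N = ENNReal.ofReal ε := by simp
    rw [hP, ← h1, ← lintegral_add_right _ measurable_const]
    refine lintegral_mono fun x => ?_
    rw [toENNReal_log_enorm]
    exact ofReal_log_add_le (norm_nonneg _) hε
  -- The positive part exceeds `P` by at most `ε`, so the lower bound `a` controls the negative part
  -- uniformly for small `ε`.
  have hneg : ∀ ε : ℝ, 0 < ε → 0 ≤ P.toReal + ε - a ∧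
      ∫⁻ x, ENNReal.ofReal (-Real.log (‖g x‖ + ε)) ∂haar N ≤
        ENNReal.ofReal (P.toReal + ε - a) := fun ε hε => by
    have hi := integrable_log_norm_add hg hε
    have h1 := h ε hε
    rw [integral_eq_lintegral_pos_part_sub_lintegral_neg_part hi] at h1
    have h2 := ENNReal.toReal_mono (ENNReal.add_ne_top.2 ⟨hPt, ENNReal.ofReal_ne_top⟩) (hpos ε hε)
    rw [ENNReal.toReal_add hPt ENNReal.ofReal_ne_top, ENNReal.toReal_ofReal hε.le] at h2
    have h3 : ∫⁻ x, ENNReal.ofReal (-Real.log (‖g x‖ + ε)) ∂haar N ≠ ⊤ := hi.neg.lintegral_lt_top.ne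
    have h4 := ENNReal.toReal_nonneg
      (a := ∫⁻ x, ENNReal.ofReal (-Real.log (‖g x‖ + ε)) ∂haar N)
    exact ⟨by linarith, (ENNReal.le_ofReal_iff_toReal_le h3 (by linarith)).2 (by linarith)⟩
  have hPa : 0 ≤ P.toReal - a := by
    refine sub_nonneg.2 (le_of_forall_pos_le_add fun ε hε => ?_)
    linarith [(hneg ε hε).1]
  have hε : ∀ k : ℕ, (0 : ℝ) < 1 / ((k : ℝ) + 1) := fun k => by positivity
  have hlim : Tendsto (fun k : ℕ => 1 / ((k : ℝ) + 1)) atTop (𝓝 0) :=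
    tendsto_one_div_add_atTop_nhds_zero_nat
  -- The limit holds also at zeros of `g`, where both sides are `⊤`; this is what lets Fatou's lemma
  -- bound the true negative part.
  have hpt : ∀ x, (-ENNReal.log ‖g x‖ₑ).toENNReal =
      liminf (fun k : ℕ => ENNReal.ofReal (-Real.log (‖g x‖ + 1 / ((k : ℝ) + 1)))) atTop := by
    intro x
    refine (Tendsto.liminf_eq ?_).symm
    rcases eq_or_ne (g x) 0 with hx | hx
    · simp only [hx, norm_zero, zero_add, enorm_zero, ENNReal.log_zero, EReal.neg_bot,
        EReal.toENNReal_top]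
      refine ENNReal.tendsto_ofReal_atTop.comp (tendsto_neg_atBot_atTop.comp
        (Real.tendsto_log_nhdsGT_zero.comp (tendsto_nhdsWithin_iff.2 ⟨hlim, ?_⟩)))
      exact Eventually.of_forall hε
    · rw [toENNReal_neg_log_enorm hx]
      refine ENNReal.tendsto_ofReal (Tendsto.neg ?_)
      have h1 : Tendsto (fun k : ℕ => ‖g x‖ + 1 / ((k : ℝ) + 1)) atTop (𝓝 ‖g x‖) := by
        simpa using hlim.const_add ‖g x‖
      exact h1.log (norm_ne_zero_iff.2 hx)
  have hM : ∫⁻ x, (-ENNReal.log ‖g x‖ₑ).toENNReal ∂haar N ≤ ENNReal.ofReal (P.toReal - a) := by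
    simp only [hpt]
    refine (lintegral_liminf_le' fun k =>
      (integrable_log_norm_add hg (hε k)).neg.aestronglyMeasurable.aemeasurable.ennreal_ofReal).trans
      ?_
    have hlim' : Tendsto (fun k : ℕ => ENNReal.ofReal (P.toReal + 1 / ((k : ℝ) + 1) - a)) atTop
        (𝓝 (ENNReal.ofReal (P.toReal - a))) := by
      refine ENNReal.tendsto_ofReal (Tendsto.sub_const ?_ _)
      simpa using hlim.const_add P.toReal
    rw [← hlim'.liminf_eq]
    exact liminf_le_liminf (Eventually.of_forall fun k => (hneg _ (hε k)).2)
  have hMt := ne_top_of_le_ne_top ENNReal.ofReal_ne_top hM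
  have hMr := ENNReal.toReal_le_of_le_ofReal hPa hM
  rw [logIntegral, ← hP, ← EReal.coe_ennreal_toReal hPt, ← EReal.coe_ennreal_toReal hMt,
    ← EReal.coe_sub, EReal.coe_le_coe_iff]
  linarith

/-! ### Monotonicity along the filtration and conclusion. -/

theorem logIntegral_condExp_le {f : UnitAddTorus (Fin N) → ℂ} (hf : MemH1 (lexOrder N) f)
    (n : Fin N) : logIntegral ((haar N)[f | sigmaFirst N n]) ≤
      logIntegral ((haar N)[f | sigmaFirst N (n + 1)]) := by
  have hg : Integrable ((haar N)[f | sigmaFirst N n]) (haar N) := integrable_condExp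
  by_cases hneg : ∫⁻ x, (-ENNReal.log ‖((haar N)[f | sigmaFirst N n]) x‖ₑ).toENNReal ∂haar N = ⊤
  · rw [logIntegral, hneg]
    simp
  -- An infinite negative part makes the left side `-∞`; a finite one forces the zero set to be
  -- null.
  · have h0 : ∀ᵐ x ∂haar N, ((haar N)[f | sigmaFirst N n]) x ≠ 0 := by
      filter_upwards [ae_lt_top' (aemeasurable_neg_log hg) hneg] with x hx h
      simp [h] at hx
    rw [logIntegral_eq_integral hg h0 hneg]
    exact coe_le_logIntegral integrable_condExp fun ε hε =>
      integral_log_norm_condExp_le hf n h0 (integrable_log_norm hg h0 hneg) hε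

theorem sum_mdiff_eq_condExp (f : UnitAddTorus (Fin N) → ℂ) (n : ℕ) :
    ∑ j ∈ Finset.range (n + 1), mdiff f j = (haar N)[f | sigmaFirst N n] := by
  induction n with
  | zero => rw [Finset.sum_range_one, sigmaFirst_zero, condExp_bot]; rfl
  | succ n ih =>
    rw [Finset.sum_range_succ, ih]
    exact add_sub_cancel _ _

/-- `𝓕_0` is trivial and `𝓕_N` is the full σ-algebra, so the chain of inequalities runs from the
constant `∫ f` to `f` itself. -/
theorem logIntegral_integral_le {f : UnitAddTorus (Fin N) → ℂ} (hf : MemH1 (lexOrder N) f) :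
    ENNReal.log ‖∫ x, f x ∂haar N‖ₑ ≤ logIntegral f := by
  have h : ∀ n ≤ N, ENNReal.log ‖∫ x, f x ∂haar N‖ₑ ≤
      logIntegral ((haar N)[f | sigmaFirst N n]) := by
    intro n
    induction n with
    | zero =>
      intro _
      rw [sigmaFirst_zero, condExp_bot, logIntegral_const]
    | succ n ih => exact fun hn => (ih (by omega)).trans (logIntegral_condExp_le hf ⟨n, hn⟩)
  refine (h N le_rfl).trans_eq (logIntegral_congr ?_)
  refine condExp_of_aestronglyMeasurable' (sigmaFirst_le N N) ?_ hf.1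
  rw [sigmaFirst_self]
  exact hf.1.aestronglyMeasurable

end

end HardyTorus

theorem proposition3p1 (N : ℕ) (f : UnitAddTorus (Fin N) → ℂ)
    (hf : HardyTorus.MemH1 (HardyTorus.lexOrder N) f) :
    (∀ n < N,
      EReal.exp (HardyTorus.logIntegral (∑ j ∈ Finset.range (n + 1), HardyTorus.mdiff f j)) ≤
        EReal.exp (HardyTorus.logIntegral (∑ j ∈ Finset.range (n + 2), HardyTorus.mdiff f j))) ∧
    ‖∫ x, f x ∂HardyTorus.haar N‖ₑ ≤ EReal.exp (HardyTorus.logIntegral f) := by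
  refine ⟨fun n hn => EReal.exp_monotone ?_, ?_⟩
  · rw [HardyTorus.sum_mdiff_eq_condExp, HardyTorus.sum_mdiff_eq_condExp]
    exact HardyTorus.logIntegral_condExp_le hf ⟨n, hn⟩
  · rw [← ENNReal.exp_log ‖∫ x, f x ∂HardyTorus.haar N‖ₑ]
    exact EReal.exp_monotone (HardyTorus.logIntegral_integral_le hf)
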